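/- Let $(X,d)$ be a compact metric space and $T:X\to X$ a continuous map. For $n\in\mathbb N$, $x\in X$, $\epsilon>0$ put $$B_n(x,\epsilon)=\{y\in X:\ d(T^ix,T^iy)<\epsilon\ \text{ for all } 0\le i\le n-1\}.$$ Suppose that $T$ has the specification property: for each $\epsilon>0$ there is an integer $m=m(\epsilon)$ such that for any finite collection of intervals $I_j=[a_j,b_j]\subset\mathbb N$, $j=1,\dots,k$, with $a_{j+1}-b_j\ge m$ for $1\le j\le k-1$, and any $x_1,\dots,x_k\in X$, there is $x\in X$ with $d(T^{p+a_j}x,T^px_j)<\epsilon$ for all $0\le p\le b_j-a_j$ and all $1\le j\le k$. For $\alpha>0$ and $x_0\in X$ let $$\mathbf D^{x_0}_\alpha=\Big\{x\in X:\ \lim_{\epsilon\to0}\limsup_{n\to\infty}\frac{\max\{t\in\mathbb N:\ T^n(x)\in B_t(x_0,\epsilon)\}}{n}\ge\alpha\Big\},$$ where the maximum is $+\infty$ if the set of such $t$ is unbounded. For $Z\subset X$, the Bowen topological entropy of $Z$ is $h^B_{top}(Z)=\lim_{\epsilon\to0}\inf\{s\in\mathbb R:\ M(Z,s,\epsilon)=0\}$,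 where $$M(Z,s,\epsilon)=\lim_{N\to\infty}\ \inf_{\Gamma}\ \sum_{B_{n_i}(x_i,\epsilon)\in\Gamma}e^{-sn_i},$$ the infimum being over all finite or countable collections $\Gamma=\{B_{n_i}(x_i,\epsilon)\}_i$ with $x_i\in X$ and $n_i\ge N$ for all $i$ that cover $Z$. Let $h_{top}(T)\in[0,\infty]$ be the topological entropy of $T$. Then for every $\alpha>0$ and every $x_0\in X$, $$h^B_{top}(\mathbf D^{x_0}_\alpha)=\frac{h_{top}(T)}{1+\alpha},$$ where the right-hand side is $\infty$ if $h_{top}(T)=\infty$. -/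

import Mathlib

open Filter Topology
open scoped ENNReal

namespace SpecDyn

variable {X : Type*} [MetricSpace X]

/-- The Bowen ball `B_n(x, ε) = {y | d(T^i x, T^i y) < ε for all 0 ≤ i ≤ n - 1}`. -/
def bowenBall (T : X → X) (n : ℕ) (x : X) (ε : ℝ) : Set X :=
  {y | ∀ i < n, dist (T^[i] x) (T^[i] y) < ε}

/-- The specification property: for each `ε > 0` there is `m` such that for all finite families
of intervals `[a j, b j]` in `ℕ` with consecutive gaps at least `m`, and all points `x j`, some
`z` satisfies `d(T^(p + a j) z, T^p (x j)) < ε` for all `0 ≤ p ≤ b j - a j` and all `j`. -/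
def Specification (T : X → X) : Prop :=
  ∀ ε : ℝ, 0 < ε → ∃ m : ℕ, ∀ (k : ℕ) (a b : Fin k → ℕ) (x : Fin k → X),
    (∀ j, a j ≤ b j) →
    (∀ i j : Fin k, (i : ℕ) + 1 = (j : ℕ) → b i + m ≤ a j) →
    ∃ z : X, ∀ j : Fin k, ∀ p : ℕ, p ≤ b j - a j →
      dist (T^[p + a j] z) (T^[p] (x j)) < ε

/-- `max {t ∈ ℕ | y ∈ B_t(x₀, ε)}`, with value `∞` when `y` stays `ε`-close to the orbit of `x₀`
forever, so that every `t` is admissible. -/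
noncomputable def shadowTime (T : X → X) (x₀ : X) (ε : ℝ) (y : X) : ℝ≥0∞ :=
  ⨆ (t : ℕ) (_ : y ∈ bowenBall T t x₀ ε), (t : ℝ≥0∞)

/-- `limsup_{n → ∞} max {t ∈ ℕ | T^n x ∈ B_t(x₀, ε)} / n`. -/
noncomputable def shadowRateAt (T : X → X) (x₀ x : X) (ε : ℝ) : ℝ≥0∞ :=
  limsup (fun n : ℕ => shadowTime T x₀ ε (T^[n] x) / (n : ℝ≥0∞)) atTop

/-- The limit of `shadowRateAt T x₀ x ε` as `ε → 0+`; it is an infimum by monotonicity in `ε`,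
see `tendsto_shadowRateAt`. -/
noncomputable def shadowRate (T : X → X) (x₀ x : X) : ℝ≥0∞ :=
  ⨅ (ε : ℝ) (_ : 0 < ε), shadowRateAt T x₀ x ε

/-- The level set `D_α^{x₀}`. -/
def shadowSet (T : X → X) (x₀ : X) (α : ℝ) : Set X :=
  {x | ENNReal.ofReal α ≤ shadowRate T x₀ x}

/-- `M(Z, s, ε, N)`: the infimum of `∑ exp (-s n_i)` over all finite or countable collections of
Bowen balls `B_{n_i}(x_i, ε)` that cover `Z` and satisfy `n_i ≥ N`. A ball is recorded as the pair
`(x_i, n_i)`. -/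
noncomputable def coverSum (T : X → X) (Z : Set X) (s ε : ℝ) (N : ℕ) : ℝ≥0∞ :=
  ⨅ (Γ : Set (X × ℕ)) (_ : Γ.Countable) (_ : ∀ p ∈ Γ, N ≤ p.2)
    (_ : Z ⊆ ⋃ p ∈ Γ, bowenBall T p.2 p.1 ε),
    ∑' p : Γ, ENNReal.ofReal (Real.exp (-s * (p.1.2 : ℝ)))

/-- `M(Z, s, ε) = lim_{N → ∞} M(Z, s, ε, N)`, see `tendsto_coverSum`. -/
noncomputable def coverMeasure (T : X → X) (Z : Set X) (s ε : ℝ) : ℝ≥0∞ :=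
  ⨆ N : ℕ, coverSum T Z s ε N

/-- `h(Z, ε) = inf {s ∈ ℝ | M(Z, s, ε) = 0}`, an extended real number. -/
noncomputable def bowenEntropyAt (T : X → X) (Z : Set X) (ε : ℝ) : EReal :=
  ⨅ (s : ℝ) (_ : coverMeasure T Z s ε = 0), (s : EReal)

/-- The Bowen topological entropy of the subset `Z`: the limit of `h(Z, ε)` as `ε → 0+`; it is a
supremum by monotonicity in `ε`, see `tendsto_bowenEntropyAt`. -/
noncomputable def bowenEntropy (T : X → X) (Z : Set X) : EReal :=
  ⨆ (ε : ℝ) (_ : 0 < ε), bowenEntropyAt T Z ε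

theorem bowenBall_mono (T : X → X) (n : ℕ) (x : X) {ε δ : ℝ} (h : ε ≤ δ) :
    bowenBall T n x ε ⊆ bowenBall T n x δ :=
  fun _ hy i hi => (hy i hi).trans_le h

theorem tendsto_shadowRateAt (T : X → X) (x₀ x : X) :
    Tendsto (shadowRateAt T x₀ x) (𝓝[>] 0) (𝓝 (shadowRate T x₀ x)) := by
  have hm : Monotone (shadowRateAt T x₀ x) := by
    intro ε δ h
    refine limsup_le_limsup (Eventually.of_forall fun n => ?_)
    refine ENNReal.div_le_div_right ?_ _
    exact iSup_mono fun t => iSup_mono' fun ht => ⟨bowenBall_mono T t x₀ h ht, le_rfl⟩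
  have := hm.tendsto_nhdsGT 0
  rwa [sInf_image] at this

theorem tendsto_coverSum (T : X → X) (Z : Set X) (s ε : ℝ) :
    Tendsto (coverSum T Z s ε) atTop (𝓝 (coverMeasure T Z s ε)) := by
  refine tendsto_atTop_iSup fun N M h => ?_
  refine iInf_mono fun Γ => iInf_mono fun _ => iInf_mono' fun hN => ⟨fun p hp => ?_, le_rfl⟩
  exact h.trans (hN p hp)

theorem tendsto_bowenEntropyAt (T : X → X) (Z : Set X) :
    Tendsto (bowenEntropyAt T Z) (𝓝[>] 0) (𝓝 (bowenEntropy T Z)) := by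
  have hm : Antitone (bowenEntropyAt T Z) := by
    intro ε δ h
    refine iInf_mono fun s => iInf_mono' fun hs => ⟨?_, le_rfl⟩
    refine le_antisymm (le_trans ?_ hs.le) bot_le
    refine iSup_mono fun N => ?_
    refine iInf_mono fun Γ => iInf_mono fun _ => iInf_mono fun _ =>
      iInf_mono' fun hZ => ⟨hZ.trans ?_, le_rfl⟩
    exact Set.iUnion₂_mono fun p _ => bowenBall_mono T p.2 p.1 h
  have := hm.tendsto_nhdsGT 0
  rwa [sSup_image] at this

end SpecDyn

/-!
Upper bound: if `x ∈ D_α` and `β < α`, then for infinitely many `n` the orbit of `x` shadows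
that of `x₀` for `⌈β n⌉` steps from time `n` on. The points of one ball `B_n(c, ε / 2)` that do
so lie in a single Bowen ball of length `n + ⌈β n⌉`, so about `exp (n h)` balls of length
`(1 + β) n` suffice for each `n`, and a Borel–Cantelli argument gives the entropy bound
`h / (1 + β)`.

Lower bound: let `E` consist of about `exp (q h)` points with pairwise disjoint Bowen balls of
length `q`. Specification codes each word `ω` in `E` by a point `z ω ∈ D_α` whose orbit
alternates between following long stretches of `ω` and following `x₀` for `α` times the time
elapsed so far. Up to every late time, a proportion of at least `θ` of the time is spent on
`ω`, for any `θ < 1 / (1 + α)` provided `q` is large. Hence the codes of points in a Bowen ball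
of length `n` agree on about `θ n / q` letters, and the uniform measure on the codes bounds
every cover of `D_α` from below.
-/

namespace SpecDyn

section BowenBall

variable {X : Type*} [MetricSpace X] {T : X → X} {n ℓ i : ℕ} {x y z : X} {ε δ : ℝ}

theorem bowenBall_antitone (T : X → X) (x : X) (ε : ℝ) : Antitone fun n => bowenBall T n x ε :=
  fun _ _ h _ hy i hi => hy i (hi.trans_le h)

theorem mem_bowenBall_comm : y ∈ bowenBall T n x ε ↔ x ∈ bowenBall T n y ε :=
  forall₂_congr fun _ _ => by rw [dist_comm]

theorem mem_bowenBall_trans (hy : y ∈ bowenBall T n x ε) (hz : z ∈ bowenBall T n y δ) :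
    z ∈ bowenBall T n x (ε + δ) :=
  fun i hi => (dist_triangle _ (T^[i] y) _).trans_lt (add_lt_add (hy i hi) (hz i hi))

theorem iterate_mem_bowenBall (hy : y ∈ bowenBall T n x ε) (h : i + ℓ ≤ n) :
    T^[i] y ∈ bowenBall T ℓ (T^[i] x) ε := fun j hj => by
  simpa only [← Function.iterate_add_apply] using hy (j + i) (by omega)

theorem mem_bowenBall_add (hn : y ∈ bowenBall T n x ε)
    (hℓ : T^[n] y ∈ bowenBall T ℓ (T^[n] x) ε) : y ∈ bowenBall T (n + ℓ) x ε := by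
  intro i hi
  rcases lt_or_ge i n with hin | hni
  · exact hn i hin
  · simpa only [← Function.iterate_add_apply, Nat.sub_add_cancel hni] using hℓ (i - n) (by omega)

theorem ball_dynEntourage_dist (T : X → X) (n : ℕ) (x : X) (ε : ℝ) :
    UniformSpace.ball x (Dynamics.dynEntourage T {p | dist p.1 p.2 < ε} n) = bowenBall T n x ε :=
  Set.ext fun _ => Dynamics.mem_ball_dynEntourage

end BowenBall

section CoverEntropy

open Dynamics

variable {X : Type*}

theorem exp_coe_mul_natCast (h : ℝ) (n : ℕ) :
    EReal.exp ((h : EReal) * (n : EReal)) = ENNReal.ofReal (Real.exp (n * h)) := by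
  rw [mul_comm (n : ℝ), ← EReal.exp_coe]
  norm_cast

theorem exists_isDynCoverOf_card_le {T : X → X} {F : Set X} {U : SetRel X X} {n : ℕ} {c : ℝ}
    (hc : 0 ≤ c) (h : (coverMincard T F U n : ℝ≥0∞) ≤ ENNReal.ofReal c) :
    ∃ s : Finset X, IsDynCoverOf T F U n s ∧ (s.card : ℝ) ≤ c := by
  have hfin : coverMincard T F U n < ⊤ := by
    rw [← ENat.toENNReal_lt, ENat.toENNReal_top]
    exact h.trans_lt ENNReal.ofReal_lt_top
  obtain ⟨s, hs, hcard⟩ := (coverMincard_finite_iff T F U n).1 hfin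
  rw [← hcard, ENat.toENNReal_coe, ← ENNReal.ofReal_natCast, ENNReal.ofReal_le_ofReal_iff hc] at h
  exact ⟨s, hs, h⟩

theorem exists_isDynNetIn_le_card {T : X → X} {F : Set X} {U : SetRel X X} {n : ℕ} {c : ℝ}
    (h : ENNReal.ofReal c ≤ (netMaxcard T F U n : ℝ≥0∞)) :
    ∃ s : Finset X, IsDynNetIn T F U n s ∧ c ≤ s.card := by
  rcases eq_top_or_lt_top (netMaxcard T F U n) with htop | hfin
  · obtain ⟨s, hs, hcard⟩ := (netMaxcard_infinite_iff T F U n).1 htop ⌈c⌉₊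
    exact ⟨s, hs, Nat.ceil_le.1 hcard⟩
  · obtain ⟨s, hs, hcard⟩ := (netMaxcard_finite_iff T F U n).1 hfin
    rw [← hcard, ENat.toENNReal_coe, ← ENNReal.ofReal_natCast,
      ENNReal.ofReal_le_ofReal_iff (Nat.cast_nonneg _)] at h
    exact ⟨s, hs, h⟩

variable [MetricSpace X] {T : X → X} {h : ℝ}

theorem eventually_exists_bowenBall_cover (hh : coverEntropy T Set.univ < (h : EReal))
    {ε : ℝ} (hε : 0 < ε) :
    ∀ᶠ n : ℕ in atTop, ∃ s : Finset X, (s.card : ℝ) ≤ Real.exp (n * h) ∧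
      ∀ x, ∃ c ∈ s, x ∈ bowenBall T n c ε := by
  have hgrowth := (coverEntropyEntourage_le_coverEntropy T Set.univ
    (Metric.dist_mem_uniformity hε)).trans_lt hh
  filter_upwards [ExpGrowth.eventually_le_exp hgrowth] with n hn
  rw [exp_coe_mul_natCast] at hn
  obtain ⟨s, hs, hcard⟩ := exists_isDynCoverOf_card_le (Real.exp_pos _).le hn
  refine ⟨s, hcard, fun x => ?_⟩
  obtain ⟨c, hc, hxc⟩ := hs (Set.mem_univ x)
  refine ⟨c, hc, mem_bowenBall_comm.1 ?_⟩
  rwa [← ball_dynEntourage_dist]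

theorem frequently_exists_pairwiseDisjoint_bowenBall (hh : (h : EReal) < coverEntropy T Set.univ) :
    ∃ δ > 0, ∃ᶠ n : ℕ in atTop, ∃ s : Finset X, Real.exp (n * h) ≤ s.card ∧
      (s : Set X).PairwiseDisjoint fun x => bowenBall T n x δ := by
  rw [coverEntropy_eq_iSup_basis_netEntropyEntourage Metric.uniformity_basis_dist] at hh
  simp only [lt_iSup_iff] at hh
  obtain ⟨δ, hδ, hgrowth⟩ := hh
  refine ⟨δ, hδ, (ExpGrowth.frequently_exp_le hgrowth).mono fun n hn => ?_⟩
  rw [exp_coe_mul_natCast] at hn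
  obtain ⟨s, ⟨-, hs⟩, hcard⟩ := exists_isDynNetIn_le_card hn
  simp only [ball_dynEntourage_dist] at hs
  exact ⟨s, hcard, hs⟩

end CoverEntropy

section BowenEntropy

variable {X : Type*} [MetricSpace X] {T : X → X} {Z : Set X} {s ε : ℝ}

theorem coverSum_le_tsum (G : ℕ → Finset X) {ℓ : ℕ → ℕ} {N : ℕ} (hℓ : ∀ k, N ≤ ℓ k)
    (hZ : ∀ x ∈ Z, ∃ k, ∃ c ∈ G k, x ∈ bowenBall T (ℓ k) c ε) :
    coverSum T Z s ε N ≤ ∑' k, ENNReal.ofReal ((G k).card * Real.exp (-s * ℓ k)) := by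
  let B : ℕ → Finset (X × ℕ) := fun k => G k ×ˢ {ℓ k}
  let w : X × ℕ → ℝ≥0∞ := fun p => ENNReal.ofReal (Real.exp (-s * (p.2 : ℝ)))
  have hcount : (⋃ k, (B k : Set (X × ℕ))).Countable :=
    Set.countable_iUnion fun k => (B k).countable_toSet
  have hlong : ∀ p ∈ ⋃ k, (B k : Set (X × ℕ)), N ≤ p.2 := by
    intro p hp
    obtain ⟨k, hk⟩ := Set.mem_iUnion.1 hp
    rw [Finset.mem_singleton.1 (Finset.mem_product.1 hk).2]
    exact hℓ k
  have hcover : Z ⊆ ⋃ p ∈ ⋃ k, (B k : Set (X × ℕ)), bowenBall T p.2 p.1 ε := by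
    intro x hx
    obtain ⟨k, c, hc, hxc⟩ := hZ x hx
    have hmem : (c, ℓ k) ∈ B k := Finset.mk_mem_product hc (Finset.mem_singleton_self _)
    exact Set.mem_biUnion (Set.mem_iUnion.2 ⟨k, hmem⟩) hxc
  calc coverSum T Z s ε N ≤ ∑' p : ⋃ k, (B k : Set (X × ℕ)), w p :=
        iInf₂_le_of_le _ hcount (iInf₂_le_of_le hlong hcover le_rfl)
    _ ≤ ∑' k, ∑' p : (B k : Set (X × ℕ)), w p := ENNReal.tsum_iUnion_le_tsum w _
    _ = ∑' k, ENNReal.ofReal ((G k).card * Real.exp (-s * ℓ k)) := by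
        refine tsum_congr fun k => (Finset.tsum_subtype' (B k) w).trans ?_
        rw [Finset.sum_product, ENNReal.ofReal_mul (Nat.cast_nonneg _), ENNReal.ofReal_natCast]
        simp only [w, Finset.sum_singleton, Finset.sum_const, nsmul_eq_mul]

/-- The Borel–Cantelli lemma for `coverMeasure`. -/
theorem coverMeasure_eq_zero_of_frequently (G : ℕ → Finset X) {ℓ : ℕ → ℕ}
    (hℓ : Tendsto ℓ atTop atTop)
    (hZ : ∀ x ∈ Z, ∃ᶠ n in atTop, ∃ c ∈ G n, x ∈ bowenBall T (ℓ n) c ε)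
    (hsum : Summable fun n => (G n).card * Real.exp (-s * ℓ n)) :
    coverMeasure T Z s ε = 0 := by
  refine le_antisymm (iSup_le fun N => ?_) bot_le
  refine ge_of_tendsto (ENNReal.tendsto_sum_nat_add _ hsum.tsum_ofReal_ne_top) ?_
  obtain ⟨M₀, hM₀⟩ := eventually_atTop.1 (hℓ.eventually_ge_atTop N)
  filter_upwards [eventually_ge_atTop M₀] with M hM
  refine coverSum_le_tsum (fun k => G (k + M)) (fun k => hM₀ _ (by omega)) fun x hx => ?_
  obtain ⟨n, hn, hxn⟩ := frequently_atTop.1 (hZ x hx) M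
  obtain ⟨k, rfl⟩ := Nat.exists_eq_add_of_le' hn
  exact ⟨k, hxn⟩

theorem coverMeasure_antitone (T : X → X) (Z : Set X) (ε : ℝ) :
    Antitone fun s => coverMeasure T Z s ε := by
  intro s s' hs
  refine iSup_mono fun n => iInf_mono fun Γ => iInf_mono fun _ => iInf_mono fun _ =>
    iInf_mono fun _ => ENNReal.tsum_le_tsum fun p => ?_
  gcongr

theorem le_bowenEntropyAt (h : coverMeasure T Z s ε ≠ 0) : (s : EReal) ≤ bowenEntropyAt T Z ε := by
  refine le_iInf₂ fun s' hs' => EReal.coe_le_coe_iff.2 (le_of_not_gt fun hlt => h ?_)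
  exact le_antisymm ((coverMeasure_antitone T Z ε hlt.le).trans_eq hs') bot_le

end BowenEntropy

section ShadowSet

variable {X : Type*} [MetricSpace X] {T : X → X} {x₀ x y : X} {α β ε : ℝ} {n : ℕ}

theorem ofReal_le_shadowTime_div (hn : 0 < n) (hy : y ∈ bowenBall T ⌈α * n⌉₊ x₀ ε) :
    ENNReal.ofReal α ≤ shadowTime T x₀ ε y / n := by
  rw [ENNReal.le_div_iff_mul_le (by simp [hn.ne']) (by simp), ← ENNReal.ofReal_natCast,
    ← ENNReal.ofReal_mul' (Nat.cast_nonneg _)]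
  calc ENNReal.ofReal (α * n) ≤ ENNReal.ofReal ⌈α * n⌉₊ := ENNReal.ofReal_le_ofReal (Nat.le_ceil _)
    _ = (⌈α * n⌉₊ : ℝ≥0∞) := ENNReal.ofReal_natCast _
    _ ≤ shadowTime T x₀ ε y :=
      le_iSup₂ (f := fun (t : ℕ) (_ : y ∈ bowenBall T t x₀ ε) => (t : ℝ≥0∞)) _ hy

theorem mem_bowenBall_of_ofReal_lt_shadowTime_div (hn : 0 < n)
    (h : ENNReal.ofReal β < shadowTime T x₀ ε y / n) : y ∈ bowenBall T ⌈β * n⌉₊ x₀ ε := by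
  rw [ENNReal.lt_div_iff_mul_lt (by simp [hn.ne']) (by simp), ← ENNReal.ofReal_natCast,
    ← ENNReal.ofReal_mul' (Nat.cast_nonneg _)] at h
  simp only [shadowTime, lt_iSup_iff] at h
  obtain ⟨t, hyt, ht⟩ := h
  rw [← ENNReal.ofReal_natCast, ENNReal.ofReal_lt_ofReal_iff'] at ht
  exact bowenBall_antitone T x₀ ε (Nat.ceil_le.2 ht.1.le) hyt

theorem frequently_mem_bowenBall_of_mem_shadowSet (hβ : β < α) (hε : 0 < ε)
    (hx : x ∈ shadowSet T x₀ α) :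
    ∃ᶠ n : ℕ in atTop, T^[n] x ∈ bowenBall T ⌈β * n⌉₊ x₀ ε := by
  rcases le_or_gt β 0 with hβ0 | hβ0
  · refine Frequently.of_forall fun n i hi => ?_
    rw [Nat.ceil_eq_zero.2 (mul_nonpos_of_nonpos_of_nonneg hβ0 (Nat.cast_nonneg _))] at hi
    exact absurd hi (Nat.not_lt_zero i)
  · have hrate : ENNReal.ofReal β < shadowRateAt T x₀ x ε :=
      ((ENNReal.ofReal_lt_ofReal_iff (hβ0.trans hβ)).2 hβ).trans_le (le_trans hx (iInf₂_le ε hε))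
    exact ((frequently_lt_of_lt_limsup (by isBoundedDefault) hrate).and_eventually
      (eventually_gt_atTop 0)).mono fun n hn => mem_bowenBall_of_ofReal_lt_shadowTime_div hn.2 hn.1

theorem mem_shadowSet_of_tendsto {b : ℕ → ℕ} {η : ℕ → ℝ} (hb : Tendsto b atTop atTop)
    (hη : Tendsto η atTop (𝓝 0)) (h : ∀ k, T^[b k] x ∈ bowenBall T ⌈α * b k⌉₊ x₀ (η k)) :
    x ∈ shadowSet T x₀ α := by
  change ENNReal.ofReal α ≤ shadowRate T x₀ x
  refine le_iInf₂ fun ε hε => le_limsup_of_frequently_le (hb.frequently (Eventually.frequently ?_))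
  filter_upwards [hb.eventually_gt_atTop 0, hη.eventually_le_const hε] with k hk hηk
  exact ofReal_le_shadowTime_div hk (bowenBall_mono T _ _ hηk (h k))

end ShadowSet

section UpperBound

variable {X : Type*} [MetricSpace X] {T : X → X} {α ε : ℝ}

theorem exists_bowenBall_supset (T : X → X) (x₀ c : X) (n ℓ : ℕ) (ε : ℝ) :
    ∃ y : X, ∀ x, x ∈ bowenBall T n c (ε / 2) → T^[n] x ∈ bowenBall T ℓ x₀ (ε / 2) →
      x ∈ bowenBall T (n + ℓ) y ε := by
  have htwo : ∀ {k : ℕ} {c x y : X}, y ∈ bowenBall T k c (ε / 2) → x ∈ bowenBall T k c (ε / 2) →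
      x ∈ bowenBall T k y ε := fun hy hx => by
    simpa only [add_halves] using mem_bowenBall_trans (mem_bowenBall_comm.1 hy) hx
  by_cases h : ∃ y, y ∈ bowenBall T n c (ε / 2) ∧ T^[n] y ∈ bowenBall T ℓ x₀ (ε / 2)
  · obtain ⟨y, hyc, hyx₀⟩ := h
    exact ⟨y, fun x hxc hxx₀ => mem_bowenBall_add (htwo hyc hxc) (htwo hyx₀ hxx₀)⟩
  · exact ⟨c, fun x hxc hxx₀ => absurd ⟨x, hxc, hxx₀⟩ h⟩

theorem eventually_exists_bowenBall_cover_shadowing {h : ℝ}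
    (hh : Dynamics.coverEntropy T Set.univ < (h : EReal)) (x₀ : X) (ℓ : ℕ → ℕ) (hε : 0 < ε) :
    ∀ᶠ n : ℕ in atTop, ∃ G : Finset X, (G.card : ℝ) ≤ Real.exp (n * h) ∧
      ∀ x, T^[n] x ∈ bowenBall T (ℓ n) x₀ (ε / 2) → ∃ c ∈ G, x ∈ bowenBall T (n + ℓ n) c ε := by
  classical
  filter_upwards [eventually_exists_bowenBall_cover hh (half_pos hε)] with n hn
  obtain ⟨F, hcard, hF⟩ := hn
  choose y hy using fun c => exists_bowenBall_supset T x₀ c n (ℓ n) ε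
  refine ⟨F.image y, (Nat.cast_le.2 Finset.card_image_le).trans hcard, fun x hx => ?_⟩
  obtain ⟨c, hc, hxc⟩ := hF x
  exact ⟨y c, Finset.mem_image_of_mem y hc, hy c x hxc hx⟩

theorem coverMeasure_shadowSet_eq_zero {s : ℝ} (hα : 0 < 1 + α)
    (h : Dynamics.coverEntropy T Set.univ < ((s * (1 + α) : ℝ) : EReal)) (x₀ : X) (hε : 0 < ε) :
    coverMeasure T (shadowSet T x₀ α) s ε = 0 := by
  obtain ⟨h', hh', hlt⟩ := EReal.lt_iff_exists_real_btwn.1 h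
  have hh'0 : 0 < h' := by
    exact_mod_cast (Dynamics.coverEntropy_nonneg T ⟨x₀, Set.mem_univ _⟩).trans_lt hh'
  have hlt : h' < s * (1 + α) := EReal.coe_lt_coe_iff.1 hlt
  have hs : 0 < s := pos_of_mul_pos_left (hh'0.trans hlt) hα.le
  obtain ⟨β, hβ, hβα⟩ : ∃ β, h' / s - 1 < β ∧ β < α :=
    exists_between (by rw [sub_lt_iff_lt_add, div_lt_iff₀ hs]; linarith)
  rw [sub_lt_iff_lt_add, div_lt_iff₀ hs] at hβ
  have : Nonempty X := ⟨x₀⟩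
  obtain ⟨G, hG⟩ := (eventually_exists_bowenBall_cover_shadowing hh' x₀
    (fun n => ⌈β * n⌉₊) hε).choice
  refine coverMeasure_eq_zero_of_frequently G (ℓ := fun n => n + ⌈β * n⌉₊)
    (tendsto_atTop_mono (fun n => Nat.le_add_right n _) tendsto_id) (fun x hx => ?_) ?_
  · exact ((frequently_mem_bowenBall_of_mem_shadowSet hβα (half_pos hε) hx).and_eventually hG).mono
      fun n hn => hn.2.2 x hn.1
  · have hgeom : Summable fun n : ℕ => Real.exp (n * (h' - s * (1 + β))) :=
      Real.summable_exp_nat_mul_iff.2 (by linarith)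
    refine hgeom.of_norm_bounded_eventually_nat (hG.mono fun n hn => ?_)
    have hlen : (1 + β) * n ≤ (n + ⌈β * n⌉₊ : ℕ) := by
      push_cast
      linarith [Nat.le_ceil (β * n)]
    rw [Real.norm_of_nonneg (by positivity)]
    calc (G n).card * Real.exp (-s * (n + ⌈β * n⌉₊ : ℕ))
        ≤ Real.exp (n * h') * Real.exp (-s * ((1 + β) * n)) :=
          mul_le_mul hn.1 (Real.exp_le_exp.2 (mul_le_mul_of_nonpos_left hlen (by linarith)))
            (Real.exp_pos _).le (Real.exp_pos _).le
      _ = Real.exp (n * (h' - s * (1 + β))) := by rw [← Real.exp_add]; ring_nf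

theorem bowenEntropy_shadowSet_le (hα : 0 < 1 + α) (x₀ : X) :
    bowenEntropy T (shadowSet T x₀ α) ≤
      Dynamics.coverEntropy T Set.univ / ((1 + α : ℝ) : EReal) := by
  refine EReal.le_of_forall_lt_iff_le.1 fun s hs => ?_
  rw [EReal.div_lt_iff (EReal.coe_pos.2 hα) (EReal.coe_ne_top _), ← EReal.coe_mul] at hs
  exact iSup₂_le fun ε hε => iInf₂_le s (coverMeasure_shadowSet_eq_zero hα hs x₀ hε)

end UpperBound

section Specification

variable {X : Type*} [MetricSpace X] {T : X → X} {ε δ : ℝ} {m m₀ : ℕ}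

/-- A gap length `m` suffices for specification with precision `ε`. In contrast to `Specification`,
the prescribed orbit segments occupy the half-open intervals `[a i, a i + ℓ i)`. -/
def IsSpecGap (T : X → X) (ε : ℝ) (m : ℕ) : Prop :=
  ∀ (N : ℕ) (a ℓ : ℕ → ℕ) (x : ℕ → X), (∀ i, i + 1 < N → a i + ℓ i + m ≤ a (i + 1)) →
    ∃ z, ∀ i < N, T^[a i] z ∈ bowenBall T (ℓ i) (x i) ε

theorem Specification.exists_isSpecGap (hT : Specification T) (hε : 0 < ε) :
    ∃ m, IsSpecGap T ε m := by
  obtain ⟨m, hm⟩ := hT ε hε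
  refine ⟨m, fun N a ℓ x h => ?_⟩
  obtain ⟨z, hz⟩ := hm N (fun i => a i) (fun i => a i + ℓ i) (fun i => x i)
    (fun i => Nat.le_add_right _ _) (fun i j hij => hij ▸ h i (hij ▸ j.2))
  refine ⟨z, fun i hi p hp => ?_⟩
  rw [dist_comm, ← Function.iterate_add_apply]
  exact hz ⟨i, hi⟩ p (by simpa only [Nat.add_sub_cancel_left] using hp.le)

theorem IsSpecGap.exists_shadow_two (hm : IsSpecGap T ε m) {b c : ℕ} (hbc : b + m ≤ c) (ℓ : ℕ)
    (x y : X) : ∃ z ∈ bowenBall T b x ε, T^[c] z ∈ bowenBall T ℓ y ε := by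
  obtain ⟨z, hz⟩ := hm 2 (fun i => if i = 0 then 0 else c) (fun i => if i = 0 then b else ℓ)
    (fun i => if i = 0 then x else y) (fun i hi => by
      obtain rfl : i = 0 := by omega
      simpa using hbc)
  exact ⟨z, by simpa using hz 0 two_pos, by simpa using hz 1 one_lt_two⟩

theorem IsSpecGap.exists_shadow_word (hm : IsSpecGap T ε m) (q N : ℕ) (w : ℕ → X) :
    ∃ z, ∀ i < N, T^[i * (q + m)] z ∈ bowenBall T q (w i) ε :=
  hm N (fun i => i * (q + m)) (fun _ => q) w fun i _ => by
    rw [add_one_mul, add_assoc]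

theorem IsSpecGap.exists_shadow_word_append (hm₀ : IsSpecGap T ε m₀) (hm : IsSpecGap T δ m)
    (q N ℓ : ℕ) (w : ℕ → X) (y : X) :
    ∃ z, (∀ i < N, T^[i * (q + m₀)] z ∈ bowenBall T q (w i) (ε + δ)) ∧
      T^[N * (q + m₀) + m] z ∈ bowenBall T ℓ y δ := by
  obtain ⟨v, hv⟩ := hm₀.exists_shadow_word q N w
  obtain ⟨z, hzv, hzy⟩ := hm.exists_shadow_two le_rfl ℓ v y
  refine ⟨z, fun i hi => mem_bowenBall_trans (hv i hi) (iterate_mem_bowenBall hzv ?_), hzy⟩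
  calc i * (q + m₀) + q ≤ (i + 1) * (q + m₀) := by rw [add_one_mul]; omega
    _ ≤ N * (q + m₀) := Nat.mul_le_mul_right _ hi

theorem exists_shadow_seq [CompleteSpace X] (hT : Continuous T) {m : ℕ → ℕ}
    (hm : ∀ k, IsSpecGap T (ε / 2 ^ k) (m k)) {a ℓ : ℕ → ℕ} (hℓ : ∀ k, 0 < ℓ k)
    (ha : ∀ k, a k + ℓ k + m (k + 1) ≤ a (k + 1)) (x : ℕ → X) :
    ∃ z, ∀ k, T^[a k] z ∈ bowenBall T (ℓ k) (x k) (ε / 2 ^ k + ε / 2 ^ k) := by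
  obtain ⟨u₀, hu₀⟩ := hm 0 1 (fun _ => a 0) (fun _ => ℓ 0) (fun _ => x 0) (by simp)
  choose f hf_old hf_new using
    fun k y => (hm (k + 1)).exists_shadow_two (ha k) (ℓ (k + 1)) y (x (k + 1))
  let u : ℕ → X := fun k => Nat.rec u₀ f k
  have hnew : ∀ k, T^[a k] (u k) ∈ bowenBall T (ℓ k) (x k) (ε / 2 ^ k)
    | 0 => hu₀ 0 one_pos
    | k + 1 => hf_new k (u k)
  have hend : Monotone fun k => a k + ℓ k := monotone_nat_of_le_succ fun k => by
    have := ha k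
    omega
  have hstep : ∀ k p, p < a k + ℓ k → ∀ j,
      dist (T^[p] (u (j + k))) (T^[p] (u (j + 1 + k))) ≤ ε / 2 ^ k / 2 / 2 ^ j := by
    intro k p hp j
    have := hf_old (j + k) (u (j + k)) p (hp.trans_le (hend (Nat.le_add_left k j)))
    rw [add_right_comm j 1 k]
    refine this.le.trans_eq ?_
    rw [pow_succ, pow_add]
    field_simp
  obtain ⟨z, hz⟩ := cauchySeq_tendsto_of_complete
    (cauchySeq_of_le_geometric_two (hstep 0 0 (Nat.add_pos_right _ (hℓ 0))))
  refine ⟨z, fun k p hp => ?_⟩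
  have hlim : dist (T^[p + a k] (u k)) (T^[p + a k] z) ≤ ε / 2 ^ k := by
    have := dist_le_of_le_geometric_two_of_tendsto₀ (hstep k (p + a k) (by omega))
      (((hT.iterate (p + a k)).tendsto z).comp (hz.comp (tendsto_add_atTop_nat k)))
    rwa [zero_add] at this
  rw [← Function.iterate_add_apply]
  have hself := hnew k p hp
  rw [← Function.iterate_add_apply] at hself
  exact (dist_triangle _ _ _).trans_lt (add_lt_add_of_lt_of_le hself hlim)

end Specification

section Schedule

variable {α θ : ℝ} {r : ℕ} {m a b N : ℕ → ℕ}

/-- Time table of the orbits used for the lower bound: stage `k` consists of `N k` coding blocks of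
length `r` from time `a k` on and, after a gap of length `m k`, of shadowing a fixed orbit from time
`b k` on for `α` times the elapsed time. The coding blocks of stage `k` alone have density at least
`θ` up to the start of the next stage, with one block to spare. -/
structure IsSchedule (α θ : ℝ) (r : ℕ) (m a b N : ℕ → ℕ) : Prop where
  shadow_start : ∀ k, b k = a k + N k * r + m k
  next_start : ∀ k, a (k + 1) = b k + ⌈α * b k⌉₊ + m (k + 1)
  pos : ∀ k, 0 < N k * r
  density : ∀ k, θ * a (k + 1) + r ≤ (N k * r : ℕ)

theorem exists_stage (hα : 0 ≤ α) (hθ : 0 ≤ θ) (hθα : θ * (1 + α) < 1) (hr : 0 < r)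
    (a m m' : ℕ) : ∃ N b : ℕ, b = a + N * r + m ∧ 0 < N * r ∧
      θ * (b + ⌈α * b⌉₊ + m' : ℕ) + r ≤ (N * r : ℕ) := by
  obtain ⟨N, hN⟩ := exists_nat_ge ((θ * ((1 + α) * (a + m) + 1 + m') + r) / (1 - θ * (1 + α)))
  rw [div_le_iff₀ (by linarith)] at hN
  have hr1 : (1 : ℝ) ≤ r := by exact_mod_cast hr
  have hdensity : θ * ((a + N * r + m : ℕ) + ⌈α * (a + N * r + m : ℕ)⌉₊ + m' : ℕ) + r ≤
      (N * r : ℕ) := by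
    have hceil := (Nat.ceil_lt_add_one
      (mul_nonneg hα (Nat.cast_nonneg (a + N * r + m)))).le
    have hNr : (N : ℝ) * (1 - θ * (1 + α)) ≤ N * (1 - θ * (1 + α)) * r :=
      le_mul_of_one_le_right (mul_nonneg (Nat.cast_nonneg _) (by linarith)) hr1
    have hθceil := mul_le_mul_of_nonneg_left hceil hθ
    push_cast at hθceil ⊢
    linarith
  refine ⟨N, _, rfl, ?_, hdensity⟩
  have : (r : ℝ) ≤ (N * r : ℕ) := le_of_add_le_of_nonneg_right hdensity (by positivity)
  exact hr.trans_le (Nat.cast_le.1 this)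

theorem exists_isSchedule (hα : 0 ≤ α) (hθ : 0 ≤ θ) (hθα : θ * (1 + α) < 1) (hr : 0 < r)
    (m : ℕ → ℕ) : ∃ a b N, IsSchedule α θ r m a b N := by
  choose N b hb hpos hdensity using
    fun k a => exists_stage hα hθ hθα hr a (m k) (m (k + 1))
  let a : ℕ → ℕ := fun k => Nat.rec 0 (fun k a => b k a + ⌈α * b k a⌉₊ + m (k + 1)) k
  exact ⟨a, fun k => b k (a k), fun k => N k (a k), fun k => hb k _, fun _ => rfl,
    fun k => hpos k _, fun k => hdensity k _⟩

namespace IsSchedule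

theorem add_mul_le_shadow_start (h : IsSchedule α θ r m a b N) (k : ℕ) :
    a k + N k * r ≤ b k :=
  h.shadow_start k ▸ Nat.le_add_right _ _

theorem shadow_start_le_next (h : IsSchedule α θ r m a b N) (k : ℕ) : b k ≤ a (k + 1) := by
  rw [h.next_start]
  omega

theorem strictMono (h : IsSchedule α θ r m a b N) : StrictMono a :=
  strictMono_nat_of_lt_succ fun k => by
    have := h.add_mul_le_shadow_start k
    have := h.shadow_start_le_next k
    have := h.pos k
    omega

theorem tendsto_shadow_start (h : IsSchedule α θ r m a b N) : Tendsto b atTop atTop :=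
  tendsto_atTop_mono
    (fun k => (Nat.le_add_right _ _).trans (h.add_mul_le_shadow_start k))
    h.strictMono.tendsto_atTop

/-- The minimum is the number of coding blocks of stage `k` that are completed by time `n`. -/
theorem mul_sub_le_completed (h : IsSchedule α θ r m a b N) (hθ : 0 ≤ θ) (hθ1 : θ ≤ 1) {k n : ℕ}
    (hk : a k ≤ n) (hn : n ≤ a (k + 1)) :
    θ * (n - a k) ≤ (min (N k) ((n - a k) / r) : ℕ) * r + r := by
  have hk' : (0 : ℝ) ≤ n - a k := sub_nonneg.2 (Nat.cast_le.2 hk)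
  rcases min_choice (N k) ((n - a k) / r) with hmin | hmin <;> rw [hmin]
  · calc θ * (n - a k) ≤ θ * a (k + 1) := by
          gcongr
          linarith [(Nat.cast_le (α := ℝ)).2 hn, Nat.cast_nonneg (α := ℝ) (a k)]
      _ ≤ N k * r + r := by
          have := h.density k
          push_cast at this
          linarith [Nat.cast_nonneg (α := ℝ) r]
  · have hdiv : n - a k ≤ (n - a k) / r * r + r := by
      rw [← add_one_mul, mul_comm]
      exact (Nat.lt_mul_div_succ _ (Nat.pos_of_mul_pos_left (h.pos k))).le
    calc θ * (n - a k) ≤ n - a k := mul_le_of_le_one_left hk' hθ1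
      _ ≤ ((n - a k) / r : ℕ) * r + r := by
          rw [← Nat.cast_sub hk]
          exact_mod_cast hdiv

/-- The pair `(k, i)` stands for the `i`-th coding block of stage `k`. -/
theorem exists_completed_blocks (h : IsSchedule α θ r m a b N) (hθ : 0 ≤ θ) (hθ1 : θ ≤ 1) {n : ℕ}
    (hn : a 1 < n) : ∃ S : Finset (ℕ × ℕ),
      (∀ p ∈ S, p.2 < N p.1 ∧ a p.1 + (p.2 + 1) * r ≤ n) ∧ θ * n ≤ S.card * r := by
  obtain ⟨j, hj, hj'⟩ := StrictMono.exists_between_of_tendsto_atTop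
    (h.strictMono.comp (strictMono_id.add_const 1))
    (h.strictMono.tendsto_atTop.comp (tendsto_add_atTop_nat 1)) hn
  simp only [Function.comp_apply, id_eq] at hj hj'
  let d := min (N (j + 1)) ((n - a (j + 1)) / r)
  refine ⟨{j} ×ˢ Finset.range (N j) ∪ {j + 1} ×ˢ Finset.range d, ?_, ?_⟩
  · rintro ⟨k, i⟩ hp
    simp only [Finset.mem_union, Finset.mem_product, Finset.mem_singleton, Finset.mem_range] at hp
    rcases hp with ⟨rfl, hi⟩ | ⟨rfl, hi⟩
    · refine ⟨hi, le_trans ?_ hj.le⟩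
      calc a k + (i + 1) * r ≤ a k + N k * r := by gcongr; exact hi
        _ ≤ a (k + 1) := (h.add_mul_le_shadow_start k).trans (h.shadow_start_le_next k)
    · have hr : 0 < r := Nat.pos_of_mul_pos_left (h.pos j)
      have hi' : (i + 1) * r ≤ n - a (j + 1) :=
        (Nat.le_div_iff_mul_le hr).1 (hi.trans_le (min_le_right _ _))
      exact ⟨hi.trans_le (min_le_left _ _), by dsimp only; omega⟩
  · rw [Finset.card_union_of_disjoint (Finset.disjoint_product.2 (Or.inl (by simp)))]
    simp only [Finset.card_product, Finset.card_singleton, Finset.card_range, one_mul]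
    have hprevious := h.density j
    have hcurrent : θ * (n - a (j + 1)) ≤ d * r + r := h.mul_sub_le_completed hθ hθ1 hj.le hj'
    push_cast at hprevious ⊢
    linarith

end IsSchedule

end Schedule

section LowerBound

open MeasureTheory in
theorem one_le_tsum_of_cylinder_cover {I E J : Type*} [Fintype E] [Nonempty E] [Countable J]
    (S : J → Finset I) (V : J → Set (I → E)) (hV : ⋃ j, V j = Set.univ)
    (hS : ∀ j, ∀ ω ∈ V j, ∀ ω' ∈ V j, ∀ i ∈ S j, ω i = ω' i) :
    1 ≤ ∑' j, ((Fintype.card E : ℝ≥0∞)⁻¹) ^ (S j).card := by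
  let _ : MeasurableSpace E := ⊤
  let ν : Measure E := (PMF.uniformOfFintype E).toMeasure
  let μ : Measure (I → E) := Measure.infinitePi fun _ => ν
  have hν : ∀ e, ν {e} = (Fintype.card E : ℝ≥0∞)⁻¹ := fun e => by
    rw [PMF.toMeasure_apply_singleton _ _ MeasurableSpace.measurableSet_top,
      PMF.uniformOfFintype_apply]
  have hμ : ∀ j, μ (V j) ≤ ((Fintype.card E : ℝ≥0∞)⁻¹) ^ (S j).card := by
    intro j
    rcases (V j).eq_empty_or_nonempty with h | ⟨ω, hω⟩
    · rw [h, measure_empty]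
      exact bot_le
    · calc μ (V j) ≤ μ (Set.pi (S j) fun i => {ω i}) :=
            measure_mono fun ω' hω' i hi => hS j ω' hω' ω hω i hi
        _ = ∏ i ∈ S j, ν {ω i} := Measure.infinitePi_pi _ fun _ _ => trivial
        _ = ((Fintype.card E : ℝ≥0∞)⁻¹) ^ (S j).card := Finset.prod_eq_pow_card fun i _ => hν (ω i)
  calc (1 : ℝ≥0∞) = μ (⋃ j, V j) := by rw [hV, measure_univ]
    _ ≤ ∑' j, μ (V j) := measure_iUnion_le _
    _ ≤ ∑' j, ((Fintype.card E : ℝ≥0∞)⁻¹) ^ (S j).card := ENNReal.tsum_le_tsum hμ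

theorem inv_natCast_pow_le_ofReal_exp {c k : ℕ} (hc : 0 < c) {t : ℝ} (h : t ≤ k * Real.log c) :
    ((c : ℝ≥0∞)⁻¹) ^ k ≤ ENNReal.ofReal (Real.exp (-t)) := by
  have hc' : (0 : ℝ) < c := Nat.cast_pos.2 hc
  calc ((c : ℝ≥0∞)⁻¹) ^ k = ENNReal.ofReal (Real.exp (-Real.log c) ^ k) := by
        rw [Real.exp_neg, Real.exp_log hc', ENNReal.ofReal_pow (inv_nonneg.2 hc'.le),
          ENNReal.ofReal_inv_of_pos hc', ENNReal.ofReal_natCast]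
    _ ≤ ENNReal.ofReal (Real.exp (-t)) := by
        rw [← Real.exp_nat_mul]
        gcongr
        linarith

variable {X : Type*} [MetricSpace X] {T : X → X} {α θ s ε δ : ℝ} {q m₀ : ℕ} {E : Finset X}

/-- Mass distribution principle for `coverSum`, applied to the uniform measure on the codes `ω`. -/
theorem one_le_coverSum_of_shadowing {I : Type*} {Z : Set X} {n₀ : ℕ} (hE : E.Nonempty)
    (hε : 0 ≤ ε)
    (hsep : (E : Set X).PairwiseDisjoint fun x => bowenBall T q x (δ + (ε + ε)))
    {τ : I → ℕ} {z : (I → E) → X} (hzZ : ∀ ω, z ω ∈ Z)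
    (hS : ∀ n ≥ n₀, ∃ S : Finset I,
      (∀ i ∈ S, τ i + q ≤ n ∧ ∀ ω, T^[τ i] (z ω) ∈ bowenBall T q (ω i) δ) ∧
        s * n ≤ S.card * Real.log E.card) :
    1 ≤ coverSum T Z s ε n₀ := by
  refine le_iInf₂ fun Γ hΓ => le_iInf₂ fun hΓn hcover => ?_
  have := hΓ.to_subtype
  have := hE.to_subtype
  choose S hS hcard using fun p : Γ => hS p.1.2 (hΓn p p.2)
  let V : Γ → Set (I → E) := fun p => {ω | z ω ∈ bowenBall T p.1.2 p.1.1 ε}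
  have hV : ⋃ p, V p = Set.univ := Set.eq_univ_of_forall fun ω => by
    obtain ⟨p, hp, hzp⟩ := Set.mem_iUnion₂.1 (hcover (hzZ ω))
    exact Set.mem_iUnion.2 ⟨⟨p, hp⟩, hzp⟩
  have hagree : ∀ p, ∀ ω ∈ V p, ∀ ω' ∈ V p, ∀ i ∈ S p, ω i = ω' i := by
    intro p ω hω ω' hω' i hi
    obtain ⟨hin, hz⟩ := hS p i hi
    have hclose : T^[τ i] (z ω') ∈ bowenBall T q (T^[τ i] (z ω)) (ε + ε) :=
      iterate_mem_bowenBall (mem_bowenBall_trans (mem_bowenBall_comm.1 hω) hω') hin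
    exact Subtype.ext (hsep.elim_set (ω i).2 (ω' i).2 _ (mem_bowenBall_trans (hz ω) hclose)
      (bowenBall_mono T q _ (by linarith) (hz ω')))
  calc 1 ≤ ∑' p, ((Fintype.card E : ℝ≥0∞)⁻¹) ^ (S p).card :=
        one_le_tsum_of_cylinder_cover S V hV hagree
    _ ≤ ∑' p : Γ, ENNReal.ofReal (Real.exp (-s * (p.1.2 : ℝ))) := by
        refine ENNReal.tsum_le_tsum fun p => ?_
        rw [Fintype.card_coe, neg_mul]
        exact inv_natCast_pow_le_ofReal_exp hE.card_pos (hcard p)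

variable [CompleteSpace X]

theorem exists_shadow_schedule (hT : Continuous T) (hε : 0 ≤ ε) (hm₀ : IsSpecGap T ε m₀)
    {m a b N : ℕ → ℕ} (hm : ∀ k, IsSpecGap T (ε / 2 ^ k) (m k))
    (h : IsSchedule α θ (q + m₀) m a b N) (x₀ : X) (w : ℕ → ℕ → X) :
    ∃ z ∈ shadowSet T x₀ α, ∀ k, ∀ i < N k,
      T^[a k + i * (q + m₀)] z ∈ bowenBall T q (w k i) (4 * ε) := by
  choose v hvw hvx₀ using
    fun k => hm₀.exists_shadow_word_append (hm k) q (N k) ⌈α * b k⌉₊ (w k) x₀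
  let ℓ : ℕ → ℕ := fun k => N k * (q + m₀) + m k + ⌈α * b k⌉₊
  have hend : ∀ k, a k + ℓ k = b k + ⌈α * b k⌉₊ := fun k => by
    have := h.shadow_start k
    simp only [ℓ]
    omega
  obtain ⟨z, hz⟩ := exists_shadow_seq hT hm (a := a) (ℓ := ℓ)
    (fun k => (h.pos k).trans_le (by simp only [ℓ]; omega))
    (fun k => by rw [hend, h.next_start]) v
  have hzv : ∀ k i n : ℕ, i + n ≤ ℓ k →
      T^[a k + i] z ∈ bowenBall T n (T^[i] (v k)) (ε / 2 ^ k + ε / 2 ^ k) := fun k i n hin => by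
    rw [add_comm (a k), Function.iterate_add_apply]
    exact iterate_mem_bowenBall (hz k) hin
  refine ⟨z, mem_shadowSet_of_tendsto (η := fun k => ε / 2 ^ k + (ε / 2 ^ k + ε / 2 ^ k))
    h.tendsto_shadow_start ?_ fun k => ?_, fun k i hi => ?_⟩
  · have hlim : Tendsto (fun k : ℕ => ε / 2 ^ k) atTop (𝓝 0) :=
      tendsto_const_nhds.div_atTop (tendsto_pow_atTop_atTop_of_one_lt one_lt_two)
    simpa only [add_zero] using hlim.add (hlim.add hlim)
  · have hbz := hzv k (N k * (q + m₀) + m k) ⌈α * b k⌉₊ le_rfl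
    rw [← add_assoc, ← h.shadow_start k] at hbz
    exact mem_bowenBall_trans (hvx₀ k) hbz
  · have hle : ε / 2 ^ k ≤ ε := div_le_self hε (one_le_pow₀ one_le_two)
    refine bowenBall_mono T q _ (by linarith)
      (mem_bowenBall_trans (hvw k i hi) (hzv k _ q ?_))
    calc i * (q + m₀) + q ≤ (i + 1) * (q + m₀) := by rw [add_one_mul]; omega
      _ ≤ N k * (q + m₀) := Nat.mul_le_mul_right _ hi
      _ ≤ ℓ k := by simp only [ℓ]; omega

theorem exists_one_le_coverSum_shadowSet (hT : Continuous T) (hspec : Specification T)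
    (hα : 0 ≤ α) (hθ : 0 ≤ θ) (hθα : θ * (1 + α) < 1) (hε : 0 < ε) (hm₀ : IsSpecGap T ε m₀)
    (hq : 0 < q) (hE : E.Nonempty)
    (hsep : (E : Set X).PairwiseDisjoint fun x => bowenBall T q x (6 * ε))
    (hs : s * (q + m₀ : ℕ) ≤ θ * Real.log E.card) (x₀ : X) :
    ∃ n₀, 1 ≤ coverSum T (shadowSet T x₀ α) s ε n₀ := by
  choose m hm using fun k : ℕ => hspec.exists_isSpecGap (ε := ε / 2 ^ k) (by positivity)
  have hr : 0 < q + m₀ := Nat.add_pos_left hq _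
  obtain ⟨a, b, N, h⟩ := exists_isSchedule hα hθ hθα hr m
  choose z hzD hz using fun ω : ℕ × ℕ → E =>
    exists_shadow_schedule hT hε.le hm₀ hm h x₀ fun k i => (ω (k, i) : X)
  refine ⟨a 1 + 1, one_le_coverSum_of_shadowing (q := q) (δ := 4 * ε) hE hε.le ?_
    (τ := fun p => a p.1 + p.2 * (q + m₀)) hzD fun n hn => ?_⟩
  · convert hsep using 3
    ring
  · obtain ⟨S, hS, hcard⟩ := h.exists_completed_blocks hθ (by nlinarith) hn
    refine ⟨S, fun p hp => ⟨?_, fun ω => hz ω p.1 p.2 (hS p hp).1⟩, ?_⟩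
    · calc a p.1 + p.2 * (q + m₀) + q ≤ a p.1 + (p.2 + 1) * (q + m₀) := by
            rw [add_one_mul]; omega
        _ ≤ n := (hS p hp).2
    · have hr' : (0 : ℝ) < (q + m₀ : ℕ) := Nat.cast_pos.2 hr
      refine le_of_mul_le_mul_right ?_ hr'
      calc s * n * (q + m₀ : ℕ) = s * (q + m₀ : ℕ) * n := mul_right_comm _ _ _
        _ ≤ θ * Real.log E.card * n := by gcongr
        _ = θ * n * Real.log E.card := mul_right_comm _ _ _
        _ ≤ S.card * (q + m₀ : ℕ) * Real.log E.card :=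
          mul_le_mul_of_nonneg_right hcard (Real.log_natCast_nonneg _)
        _ = S.card * Real.log E.card * (q + m₀ : ℕ) := mul_right_comm _ _ _

theorem exists_pos_mul_lt_one_and_lt_mul {h : ℝ} (hα : 0 < 1 + α) (hs : s * (1 + α) < h) :
    ∃ θ : ℝ, 0 < θ ∧ θ * (1 + α) < 1 ∧ s < θ * h := by
  have hlim : Tendsto (fun θ : ℝ => θ * h) (𝓝[<] (1 + α)⁻¹) (𝓝 ((1 + α)⁻¹ * h)) :=
    (continuous_mul_const h).continuousWithinAt
  have hs' : s < (1 + α)⁻¹ * h := by rwa [lt_inv_mul_iff₀ hα, mul_comm]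
  obtain ⟨θ, hθs, hθ0, hθα⟩ := ((hlim.eventually_const_lt hs').and
    (Ioo_mem_nhdsLT (inv_pos.2 hα))).exists
  exact ⟨θ, hθ0, by rwa [← lt_div_iff₀ hα, one_div], hθs⟩

theorem le_bowenEntropy_shadowSet (hT : Continuous T) (hspec : Specification T) (hα : 0 ≤ α)
    (x₀ : X) : Dynamics.coverEntropy T Set.univ / ((1 + α : ℝ) : EReal) ≤
      bowenEntropy T (shadowSet T x₀ α) := by
  have hα' : 0 < 1 + α := by linarith
  refine EReal.ge_of_forall_gt_iff_ge.1 fun s hs => ?_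
  rw [EReal.lt_div_iff (EReal.coe_pos.2 hα') (EReal.coe_ne_top _), ← EReal.coe_mul] at hs
  obtain ⟨h, hsh, hh⟩ := EReal.lt_iff_exists_real_btwn.1 hs
  obtain ⟨θ, hθ, hθα, hsθ⟩ := exists_pos_mul_lt_one_and_lt_mul hα' (EReal.coe_lt_coe_iff.1 hsh)
  obtain ⟨δ, hδ, hsep⟩ := frequently_exists_pairwiseDisjoint_bowenBall hh
  obtain ⟨m₀, hm₀⟩ := hspec.exists_isSpecGap (show 0 < δ / 6 by positivity)
  have hlarge : ∀ᶠ q : ℕ in atTop, s * m₀ ≤ q * (θ * h - s) :=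
    (tendsto_natCast_atTop_atTop.atTop_mul_const (sub_pos.2 hsθ)).eventually_ge_atTop _
  obtain ⟨q, ⟨E, hcard, hE⟩, hq, hlarge⟩ :=
    (hsep.and_eventually ((eventually_gt_atTop 0).and hlarge)).exists
  have hE₀ : (0 : ℝ) < E.card := (Real.exp_pos _).trans_le hcard
  have hsE : s * (q + m₀ : ℕ) ≤ θ * Real.log E.card := calc
    s * (q + m₀ : ℕ) ≤ θ * (q * h) := by push_cast; linarith
    _ ≤ θ * Real.log E.card :=
      mul_le_mul_of_nonneg_left ((Real.le_log_iff_exp_le hE₀).2 hcard) hθ.le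
  obtain ⟨n₀, hn₀⟩ := exists_one_le_coverSum_shadowSet hT hspec hα hθ.le hθα
    (show 0 < δ / 6 by positivity) hm₀ hq (Finset.card_pos.1 (Nat.cast_pos.1 hE₀))
    (by rwa [mul_div_cancel₀ _ (by norm_num)]) hsE x₀
  have hne : coverMeasure T (shadowSet T x₀ α) s (δ / 6) ≠ 0 :=
    (one_pos.trans_le (hn₀.trans (le_iSup _ n₀))).ne'
  exact (le_bowenEntropyAt hne).trans (le_iSup₂ (f := fun ε (_ : 0 < ε) => bowenEntropyAt T _ ε)
    (δ / 6) (by positivity))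

end LowerBound

end SpecDyn

theorem theorem1p1_general {X : Type*} [MetricSpace X] [CompleteSpace X] (T : X → X)
    (hT : Continuous T) (hspec : SpecDyn.Specification T) (α : ℝ) (hα : 0 ≤ α) (x₀ : X) :
    SpecDyn.bowenEntropy T (SpecDyn.shadowSet T x₀ α) =
      Dynamics.coverEntropy T Set.univ / ((1 + α : ℝ) : EReal) :=
  le_antisymm (SpecDyn.bowenEntropy_shadowSet_le (by linarith) x₀)
    (SpecDyn.le_bowenEntropy_shadowSet hT hspec hα x₀)

theorem theorem1p1 {X : Type*} [MetricSpace X] [CompactSpace X] (T : X → X)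
    (hT : Continuous T) (hspec : SpecDyn.Specification T) (α : ℝ) (hα : 0 < α) (x₀ : X) :
    SpecDyn.bowenEntropy T (SpecDyn.shadowSet T x₀ α) =
      Dynamics.coverEntropy T Set.univ / ((1 + α : ℝ) : EReal) :=
  theorem1p1_general T hT hspec α hα.le x₀
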